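/- Let $(\mathcal C,\mathbb E,\mathfrak s)$ be an extriangulated category in the sense of Nakaoka and Palu; that is, $\mathcal C$ is an additive category, $\mathbb E\colon \mathcal C^{\mathrm{op}}\times\mathcal C\to \mathrm{Ab}$ is an additive bifunctor, $\mathfrak s$ is an additive realization of $\mathbb E$, and the axioms (ET3), (ET3)$^{\mathrm{op}}$, (ET4), (ET4)$^{\mathrm{op}}$ hold. A sequence $A\to B\to C$ realizing some $\delta\in\mathbb E(C,A)$ is called, together with $\delta$, an $\mathbb E$-triangle. Let $\mathcal X$ be a full subcategory of $\mathcal C$. A morphism $f\colon A\to B$ is a left $\mathcal X$-approximation of $A$ if $B\in\mathcal X$ and $\mathcal C(f,X)\colon\mathcal C(B,X)\to\mathcal C(A,X)$ is surjective for all $X\in\mathcal X$; it is a right $\mathcal X$-approximation of $B$ if $A\in\mathcal X$ and $\mathcal C(X,f)\colon\mathcal C(X,A)\to\mathcal C(X,B)$ is surjective for all $X\in\mathcal X$. Assume that $\mathcal X$ is pseudo cluster tilting, i.e. for every object $C$ of $\mathcal C$ - there is an $\mathbb E$-triangle $C\xrightarrow{a}X_1\to X_2\dashrightarrow$ with $X_1,X_2\in\mathcal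 X$ and $a$ a left $\mathcal X$-approximation of $C$, and - there is an $\mathbb E$-triangle $X_3\to X_4\xrightarrow{d}C\dashrightarrow$ with $X_3,X_4\in\mathcal X$ and $d$ a right $\mathcal X$-approximation of $C$. Let $\mathcal C/\mathcal X$ be the category with the same objects as $\mathcal C$ and with morphism groups $\mathcal C(A,B)/\mathcal X(A,B)$, where $\mathcal X(A,B)$ is the subgroup of $\mathcal C(A,B)$ consisting of the morphisms which factor through an object of $\mathcal X$. Then $\mathcal C/\mathcal X$ is semi-abelian: it is an additive category with kernels and cokernels, and for every morphism $f$ of $\mathcal C/\mathcal X$ the canonical morphism $\operatorname{Coim} f\to\operatorname{Im} f$, where $\operatorname{Coim} f=\operatorname{Coker}(\operatorname{Ker} f)$ and $\operatorname{Im} f=\operatorname{Ker}(\operatorname{Coker} f)$, is both a monomorphism and an epimorphism. -/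

import Mathlib

open CategoryTheory CategoryTheory.Limits Opposite

universe w v u

/-! ## Extriangulated categories (Nakaoka and Palu) -/

/-- A sequence `A ⟶ B ⟶ C` with prescribed end terms `A` and `C`. -/
structure EndSeq {C : Type u} [Category.{v} C] (A Z : C) where
  /-- The middle term. -/
  mid : C
  /-- The first morphism. -/
  left : A ⟶ mid
  /-- The second morphism. -/
  right : mid ⟶ Z

/-- Two sequences with the same end terms are equivalent if there is an isomorphism of their middle
terms compatible with the identities of the end terms. -/
instance EndSeq.setoid {C : Type u} [Category.{v} C] (A Z : C) : Setoid (EndSeq A Z) where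
  r S T := ∃ b : S.mid ≅ T.mid, S.left ≫ b.hom = T.left ∧ b.hom ≫ T.right = S.right
  iseqv :=
    { refl := fun S => ⟨Iso.refl _, by simp, by simp⟩
      symm := by
        rintro S T ⟨b, h₁, h₂⟩
        exact ⟨b.symm, by simp [← h₁], by simp [← h₂]⟩
      trans := by
        rintro S T U ⟨b, h₁, h₂⟩ ⟨c, h₃, h₄⟩
        exact ⟨b ≪≫ c, by simp [← h₃, ← h₁], by simp [← h₂, ← h₄]⟩ }

/-- The data `(𝔼, 𝔰)` on an additive category `C`: a bifunctor `𝔼 : Cᵒᵖ × C ⥤ Ab` together with a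
correspondence `𝔰` which associates with every extension `δ ∈ 𝔼(Z, A)` an equivalence class of
sequences `A ⟶ B ⟶ Z`. -/
structure ExtensionData (C : Type u) [Category.{v} C] where
  /-- The bifunctor `𝔼`. -/
  E : Cᵒᵖ ⥤ C ⥤ AddCommGrpCat.{w}
  /-- The correspondence `𝔰`. -/
  s : ∀ {A Z : C}, ((E.obj (op Z)).obj A) → Quotient (EndSeq.setoid A Z)

namespace ExtensionData

section

variable {C : Type u} [Category.{v} C] (𝓔 : ExtensionData.{w} C)

/-- The group `𝔼(Z, A)` of extensions of `Z` by `A`. -/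
abbrev Ext (Z A : C) : Type w := (𝓔.E.obj (op Z)).obj A

/-- The pushforward `a_* δ = 𝔼(Z, a)(δ)`. -/
def push {Z A A' : C} (a : A ⟶ A') (δ : 𝓔.Ext Z A) : 𝓔.Ext Z A' :=
  ((𝓔.E.obj (op Z)).map a).hom δ

/-- The pullback `c^* δ = 𝔼(c, A)(δ)`. -/
def pull {Z Z' A : C} (c : Z' ⟶ Z) (δ : 𝓔.Ext Z A) : 𝓔.Ext Z' A :=
  ((𝓔.E.map c.op).app A).hom δ

/-- The sequence `A ⟶ B ⟶ Z` realizes `δ`, i.e. its class is `𝔰(δ)`; in other words,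
`A ⟶ B ⟶ Z ⇢ δ` is an `𝔼`-triangle. -/
def Realizes {A B Z : C} (x : A ⟶ B) (y : B ⟶ Z) (δ : 𝓔.Ext Z A) : Prop :=
  𝓔.s δ = Quotient.mk _ (EndSeq.mk B x y)

/-- `(a, c)` is a morphism of extensions `δ ⟶ δ'`. -/
def IsExtHom {A A' Z Z' : C} (a : A ⟶ A') (c : Z ⟶ Z') (δ : 𝓔.Ext Z A) (δ' : 𝓔.Ext Z' A') : Prop :=
  𝓔.push a δ = 𝓔.pull c δ'

/-- The direct sum `δ ⊕ δ'` of extensions: the element of `𝔼(Z ⊞ Z', A ⊞ A')` with components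
`(δ, 0, 0, δ')`. -/
noncomputable def dirSum [HasZeroMorphisms C] [HasBinaryBiproducts C] {A A' Z Z' : C}
    (δ : 𝓔.Ext Z A) (δ' : 𝓔.Ext Z' A') : 𝓔.Ext (Z ⊞ Z') (A ⊞ A') :=
  𝓔.push biprod.inl (𝓔.pull biprod.fst δ) + 𝓔.push biprod.inr (𝓔.pull biprod.snd δ')

end

variable {C : Type u} [Category.{v} C] [Preadditive C] [HasBinaryBiproducts C]

/-- `(C, 𝔼, 𝔰)` is an extriangulated category: `𝔼` is an additive bifunctor, `𝔰` is an additive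
realization of `𝔼`, and the axioms (ET3), (ET3)ᵒᵖ, (ET4), (ET4)ᵒᵖ hold. (`C` is additive in the
intended use.) -/
structure IsExtriangulated (𝓔 : ExtensionData.{w} C) : Prop where
  /-- `𝔼` is additive in the contravariant variable. -/
  additive_left : 𝓔.E.Additive
  /-- `𝔼` is additive in the covariant variable. -/
  additive_right : ∀ Z : Cᵒᵖ, (𝓔.E.obj Z).Additive
  /-- `𝔰` is a realization: a morphism of extensions lifts to realizing sequences. -/
  realization : ∀ {A B Z A' B' Z' : C} {x : A ⟶ B} {y : B ⟶ Z} {δ : 𝓔.Ext Z A}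
    {x' : A' ⟶ B'} {y' : B' ⟶ Z'} {δ' : 𝓔.Ext Z' A'},
    𝓔.Realizes x y δ → 𝓔.Realizes x' y' δ' →
    ∀ (a : A ⟶ A') (c : Z ⟶ Z'), 𝓔.IsExtHom a c δ δ' →
      ∃ b : B ⟶ B', x ≫ b = a ≫ x' ∧ y ≫ c = b ≫ y'
  /-- The zero extension is realized by the split sequence. -/
  realizes_zero : ∀ A Z : C,
    𝓔.Realizes (biprod.inl : A ⟶ A ⊞ Z) (biprod.snd : A ⊞ Z ⟶ Z) (0 : 𝓔.Ext Z A)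
  /-- The direct sum of extensions is realized by the direct sum of sequences. -/
  realizes_dirSum : ∀ {A B Z A' B' Z' : C} {x : A ⟶ B} {y : B ⟶ Z} {δ : 𝓔.Ext Z A}
    {x' : A' ⟶ B'} {y' : B' ⟶ Z'} {δ' : 𝓔.Ext Z' A'},
    𝓔.Realizes x y δ → 𝓔.Realizes x' y' δ' →
      𝓔.Realizes (biprod.map x x') (biprod.map y y') (𝓔.dirSum δ δ')
  /-- (ET3) -/
  et3 : ∀ {A B Z A' B' Z' : C} {x : A ⟶ B} {y : B ⟶ Z} {δ : 𝓔.Ext Z A}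
    {x' : A' ⟶ B'} {y' : B' ⟶ Z'} {δ' : 𝓔.Ext Z' A'},
    𝓔.Realizes x y δ → 𝓔.Realizes x' y' δ' →
    ∀ (a : A ⟶ A') (b : B ⟶ B'), x ≫ b = a ≫ x' →
      ∃ c : Z ⟶ Z', y ≫ c = b ≫ y' ∧ 𝓔.IsExtHom a c δ δ'
  /-- (ET3)ᵒᵖ -/
  et3_op : ∀ {A B Z A' B' Z' : C} {x : A ⟶ B} {y : B ⟶ Z} {δ : 𝓔.Ext Z A}
    {x' : A' ⟶ B'} {y' : B' ⟶ Z'} {δ' : 𝓔.Ext Z' A'},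
    𝓔.Realizes x y δ → 𝓔.Realizes x' y' δ' →
    ∀ (b : B ⟶ B') (c : Z ⟶ Z'), y ≫ c = b ≫ y' →
      ∃ a : A ⟶ A', x ≫ b = a ≫ x' ∧ 𝓔.IsExtHom a c δ δ'
  /-- (ET4), for `A ⟶ B ⟶ D ⇢ δ` and `B ⟶ M ⟶ F ⇢ δ'`. -/
  et4 : ∀ {A B D M F : C} {f : A ⟶ B} {f' : B ⟶ D} {g : B ⟶ M} {g' : M ⟶ F}
    {δ : 𝓔.Ext D A} {δ' : 𝓔.Ext F B},
    𝓔.Realizes f f' δ → 𝓔.Realizes g g' δ' →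
      ∃ (N : C) (h' : M ⟶ N) (d : D ⟶ N) (e : N ⟶ F) (δ'' : 𝓔.Ext N A),
        𝓔.Realizes (f ≫ g) h' δ'' ∧ f' ≫ d = g ≫ h' ∧ h' ≫ e = g' ∧
        𝓔.Realizes d e (𝓔.push f' δ') ∧
        𝓔.pull d δ'' = δ ∧ 𝓔.push f δ'' = 𝓔.pull e δ'
  /-- (ET4)ᵒᵖ, for `D ⟶ A ⟶ B ⇢ δ` and `F ⟶ B ⟶ M ⇢ δ'`. -/
  et4_op : ∀ {D A B F M : C} {f' : D ⟶ A} {f : A ⟶ B} {g' : F ⟶ B} {g : B ⟶ M}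
    {δ : 𝓔.Ext B D} {δ' : 𝓔.Ext M F},
    𝓔.Realizes f' f δ → 𝓔.Realizes g' g δ' →
      ∃ (N : C) (h' : N ⟶ A) (d : D ⟶ N) (e : N ⟶ F) (δ'' : 𝓔.Ext M N),
        𝓔.Realizes h' (f ≫ g) δ'' ∧ h' ≫ f = e ≫ g' ∧ d ≫ h' = f' ∧
        𝓔.Realizes d e (𝓔.pull g' δ) ∧
        𝓔.push e δ'' = δ' ∧ 𝓔.pull g δ'' = 𝓔.push d δ

end ExtensionData

/-! ## Approximations and pseudo cluster tilting subcategories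

A full subcategory is given by the predicate of its objects. -/

/-- `f : A ⟶ B` is a left `𝒳`-approximation of `A`: `B ∈ 𝒳`, and `Hom(B, X) → Hom(A, X)` is
surjective for every `X ∈ 𝒳`. -/
def IsLeftApprox {C : Type u} [Category.{v} C] (𝒳 : ObjectProperty C) {A B : C} (f : A ⟶ B) :
    Prop :=
  𝒳 B ∧ ∀ X : C, 𝒳 X → Function.Surjective fun g : B ⟶ X => f ≫ g

/-- `f : A ⟶ B` is a right `𝒳`-approximation of `B`: `A ∈ 𝒳`, and `Hom(X, A) → Hom(X, B)` is
surjective for every `X ∈ 𝒳`. -/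
def IsRightApprox {C : Type u} [Category.{v} C] (𝒳 : ObjectProperty C) {A B : C} (f : A ⟶ B) :
    Prop :=
  𝒳 A ∧ ∀ X : C, 𝒳 X → Function.Surjective fun g : X ⟶ A => g ≫ f

/-- A full subcategory `𝒳` is pseudo cluster tilting if every object `A` has `𝔼`-triangles
`A ⟶ X₁ ⟶ X₂ ⇢` and `X₃ ⟶ X₄ ⟶ A ⇢` with all `Xᵢ ∈ 𝒳`, where `A ⟶ X₁` is a left and
`X₄ ⟶ A` is a right `𝒳`-approximation. -/
structure IsPseudoClusterTilting {C : Type u} [Category.{v} C] (𝓔 : ExtensionData.{w} C)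
    (𝒳 : ObjectProperty C) : Prop where
  exists_left : ∀ A : C, ∃ (X₁ X₂ : C) (a : A ⟶ X₁) (b : X₁ ⟶ X₂) (δ : 𝓔.Ext X₂ A),
    𝓔.Realizes a b δ ∧ 𝒳 X₁ ∧ 𝒳 X₂ ∧ IsLeftApprox 𝒳 a
  exists_right : ∀ A : C, ∃ (X₃ X₄ : C) (c : X₃ ⟶ X₄) (d : X₄ ⟶ A) (η : 𝓔.Ext A X₃),
    𝓔.Realizes c d η ∧ 𝒳 X₃ ∧ 𝒳 X₄ ∧ IsRightApprox 𝒳 d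

/-! ## The additive quotient -/

section

variable {C : Type u} [Category.{v} C]

/-- `f` factors through an object of `𝒳`. -/
def FactorsThroughObj (𝒳 : ObjectProperty C) {A B : C} (f : A ⟶ B) : Prop :=
  ∃ (X : C) (_ : 𝒳 X) (i : A ⟶ X) (p : X ⟶ B), i ≫ p = f

variable [Preadditive C] (𝒳 : ObjectProperty C)

/-- The subgroup `𝒳(A, B)` of `Hom(A, B)` generated by the morphisms which factor through an object
of `𝒳`. For a pseudo cluster tilting `𝒳` these morphisms already form a subgroup, see
`IsPseudoClusterTilting.mem_factorSubgroup_iff`. -/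
def factorSubgroup (A B : C) : AddSubgroup (A ⟶ B) :=
  AddSubgroup.closure {f | FactorsThroughObj 𝒳 f}

theorem IsPseudoClusterTilting.mem_factorSubgroup_iff {𝓔 : ExtensionData.{w} C}
    {𝒳 : ObjectProperty C} (h : IsPseudoClusterTilting 𝓔 𝒳) {A B : C} (f : A ⟶ B) :
    f ∈ factorSubgroup 𝒳 A B ↔ FactorsThroughObj 𝒳 f := by
  refine ⟨fun hf => ?_, fun hf => AddSubgroup.subset_closure hf⟩
  obtain ⟨X₁, X₂, a, b, δ, -, h₁, -, -, ha⟩ := h.exists_left A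
  have key : ∀ g : A ⟶ B, FactorsThroughObj 𝒳 g → ∃ p : X₁ ⟶ B, a ≫ p = g := by
    rintro g ⟨X, hX, i, p, rfl⟩
    obtain ⟨j, hj⟩ := ha X hX i
    exact ⟨j ≫ p, by simp only at hj; rw [← Category.assoc, hj]⟩
  suffices ∃ p : X₁ ⟶ B, a ≫ p = f from this.elim fun p hp => ⟨X₁, h₁, a, p, hp⟩
  induction hf using AddSubgroup.closure_induction with
  | mem x hx => exact key x hx
  | zero => exact ⟨0, by simp⟩
  | add x y _ _ hx hy =>
    obtain ⟨p, rfl⟩ := hx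
    obtain ⟨q, rfl⟩ := hy
    exact ⟨p + q, by simp⟩
  | neg x _ hx =>
    obtain ⟨p, rfl⟩ := hx
    exact ⟨-p, by simp⟩

theorem comp_mem_factorSubgroup {A B D : C} (f : A ⟶ B) {g : B ⟶ D}
    (hg : g ∈ factorSubgroup 𝒳 B D) : f ≫ g ∈ factorSubgroup 𝒳 A D := by
  induction hg using AddSubgroup.closure_induction with
  | mem x hx =>
    obtain ⟨X, hX, i, p, rfl⟩ := hx
    exact AddSubgroup.subset_closure ⟨X, hX, f ≫ i, p, by simp⟩
  | zero => simp
  | add x y _ _ hx hy => simpa using add_mem hx hy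
  | neg x _ hx => simpa using hx

theorem mem_factorSubgroup_comp {A B D : C} {f : A ⟶ B} (g : B ⟶ D)
    (hf : f ∈ factorSubgroup 𝒳 A B) : f ≫ g ∈ factorSubgroup 𝒳 A D := by
  induction hf using AddSubgroup.closure_induction with
  | mem x hx =>
    obtain ⟨X, hX, i, p, rfl⟩ := hx
    exact AddSubgroup.subset_closure ⟨X, hX, i, p ≫ g, by simp⟩
  | zero => simp
  | add x y _ _ hx hy => simpa using add_mem hx hy
  | neg x _ hx => simpa using hx

/-- Two parallel morphisms are identified in `C/𝒳` if their difference lies in `𝒳(A, B)`. -/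
def factorRel : HomRel C := fun A B f g => f - g ∈ factorSubgroup 𝒳 A B

instance : Congruence (factorRel 𝒳) where
  equivalence :=
    { refl := fun f => by simp [factorRel]
      symm := fun {f g} h => by
        have := neg_mem h
        rwa [neg_sub] at this
      trans := fun {f g k} h h' => by
        have := add_mem h h'
        rwa [sub_add_sub_cancel] at this }
  comp_left f g g' h := by
    have := comp_mem_factorSubgroup 𝒳 f h
    rwa [Preadditive.comp_sub] at this
  comp_right g h := by
    have := mem_factorSubgroup_comp 𝒳 g h
    rwa [Preadditive.sub_comp] at this

/-- The quotient category `C/𝒳`: its objects are those of `C`, its morphisms are the elements of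
`Hom(A, B)/𝒳(A, B)`. -/
abbrev AdditiveQuotient := CategoryTheory.Quotient (factorRel 𝒳)

/-- Addition of morphisms in `C/𝒳` is induced by addition in `C`. -/
instance : Preadditive (AdditiveQuotient 𝒳) :=
  CategoryTheory.Quotient.preadditive _ fun _ _ f₁ f₂ g₁ g₂ hf hg => by
    have := add_mem hf hg
    rwa [sub_add_sub_comm] at this

end

/-! ## Semi-abelian categories -/

/-- A semi-abelian category: an additive category with kernels and cokernels in which, for every
morphism `f`, the canonical morphism `Coim f ⟶ Im f` is both a monomorphism and an epimorphism. -/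
structure IsSemiAbelian (D : Type u) [Category.{v} D] [Preadditive D] : Prop where
  hasZeroObject : HasZeroObject D
  hasBinaryBiproducts : HasBinaryBiproducts D
  hasKernels : HasKernels D
  hasCokernels : HasCokernels D
  mono_coimageImageComparison : ∀ {X Y : D} (f : X ⟶ Y),
    Mono (Abelian.coimageImageComparison f)
  epi_coimageImageComparison : ∀ {X Y : D} (f : X ⟶ Y),
    Epi (Abelian.coimageImageComparison f)

/-! Two constructions in `C`, each with a dual, carry the proof. Kernels: for `f : A ⟶ B`, pull back
along `f` the extension given by a right `𝒳`-approximation of `B`. The deflation `k : K ⟶ A`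
realizing the pullback becomes a kernel of `f` in the quotient (`exists_kernel`). Cokernels are
dual, by pushing out a left approximation of `A` (`exists_cokernel`). Comparison map: Coim `f ⟶` Im
`f` is an epimorphism as soon as `f` is an epimorphism `e : A ⟶ K` followed by a weak kernel `n : K
⟶ B` of a morphism that `f` annihilates, for then Im `f` is a retract of `K`. To find `K`, add a
left approximation `A ⟶ X₁` to `f`, which makes `A ⟶ X₁ ⊞ B` an inflation with cokernel `L`, and
take the homotopy pullback of `X₁ ⊞ B ⟶ L` and a right approximation `X₄ ⟶ L`
(`exists_epi_weakKernel`). The dual construction gives the monomorphism. -/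

namespace ExtensionData

/-! ### Functoriality of extensions and uniqueness of realizations. -/

section

variable {C : Type u} [Category.{v} C] (𝓔 : ExtensionData.{w} C)

@[simp]
theorem push_zero_right {Z A A' : C} (a : A ⟶ A') : 𝓔.push a (0 : 𝓔.Ext Z A) = 0 :=
  map_zero _

@[simp]
theorem pull_zero_right {Z Z' A : C} (c : Z' ⟶ Z) : 𝓔.pull c (0 : 𝓔.Ext Z A) = 0 :=
  map_zero _

theorem push_add_right {Z A A' : C} (a : A ⟶ A') (δ δ' : 𝓔.Ext Z A) :
    𝓔.push a (δ + δ') = 𝓔.push a δ + 𝓔.push a δ' :=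
  map_add _ _ _

theorem pull_add_right {Z Z' A : C} (c : Z' ⟶ Z) (δ δ' : 𝓔.Ext Z A) :
    𝓔.pull c (δ + δ') = 𝓔.pull c δ + 𝓔.pull c δ' :=
  map_add _ _ _

@[simp]
theorem push_id {Z A : C} (δ : 𝓔.Ext Z A) : 𝓔.push (𝟙 A) δ = δ := by
  simp [push]

@[simp]
theorem pull_id {Z A : C} (δ : 𝓔.Ext Z A) : 𝓔.pull (𝟙 Z) δ = δ := by
  simp [pull]

theorem push_push {Z A A' A'' : C} (a : A ⟶ A') (a' : A' ⟶ A'') (δ : 𝓔.Ext Z A) :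
    𝓔.push a' (𝓔.push a δ) = 𝓔.push (a ≫ a') δ := by
  simp [push]

theorem pull_pull {Z Z' Z'' A : C} (c : Z' ⟶ Z) (c' : Z'' ⟶ Z') (δ : 𝓔.Ext Z A) :
    𝓔.pull c' (𝓔.pull c δ) = 𝓔.pull (c' ≫ c) δ := by
  simp [pull]

theorem push_pull {Z Z' A A' : C} (a : A ⟶ A') (c : Z' ⟶ Z) (δ : 𝓔.Ext Z A) :
    𝓔.push a (𝓔.pull c δ) = 𝓔.pull c (𝓔.push a δ) :=
  (ConcreteCategory.congr_hom ((𝓔.E.map c.op).naturality a) δ).symm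

theorem exists_realizes {A Z : C} (δ : 𝓔.Ext Z A) :
    ∃ (B : C) (x : A ⟶ B) (y : B ⟶ Z), 𝓔.Realizes x y δ := by
  obtain ⟨S, hS⟩ := Quotient.exists_rep (𝓔.s δ)
  exact ⟨S.mid, S.left, S.right, hS.symm⟩

variable {𝓔}

theorem Realizes.of_iso {A B B' Z : C} {x : A ⟶ B} {y : B ⟶ Z} {δ : 𝓔.Ext Z A}
    (h : 𝓔.Realizes x y δ) (i : B ≅ B') {x' : A ⟶ B'} {y' : B' ⟶ Z}
    (hx : x ≫ i.hom = x') (hy : i.hom ≫ y' = y) : 𝓔.Realizes x' y' δ :=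
  h.trans (Quotient.sound ⟨i, hx, hy⟩)

theorem Realizes.exists_iso {A B B' Z : C} {x : A ⟶ B} {y : B ⟶ Z} {δ : 𝓔.Ext Z A}
    {x' : A ⟶ B'} {y' : B' ⟶ Z} (h : 𝓔.Realizes x y δ) (h' : 𝓔.Realizes x' y' δ) :
    ∃ i : B ≅ B', x ≫ i.hom = x' ∧ i.hom ≫ y' = y :=
  Quotient.exact (h.symm.trans h')

end

variable {C : Type u} [Category.{v} C] [Preadditive C] [HasBinaryBiproducts C]
  {𝓔 : ExtensionData.{w} C}

/-! ### Weak exactness of `𝔼`-triangles, homotopy pullbacks and pushouts. -/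

namespace IsExtriangulated

theorem push_zero_left (h : 𝓔.IsExtriangulated) {Z A A' : C} (δ : 𝓔.Ext Z A) :
    𝓔.push (0 : A ⟶ A') δ = 0 := by
  have := h.additive_right (op Z)
  simp [push]

theorem pull_zero_left (h : 𝓔.IsExtriangulated) {Z Z' A : C} (δ : 𝓔.Ext Z A) :
    𝓔.pull (0 : Z' ⟶ Z) δ = 0 := by
  have := h.additive_left
  simp [pull]

variable [HasZeroObject C]

-- The two trivial triangles serve as test objects: each exactness statement below compares a given
-- triangle with one of them.
open ZeroObject in
theorem realizes_id_left (h : 𝓔.IsExtriangulated) (A : C) :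
    𝓔.Realizes (𝟙 A) (0 : A ⟶ 0) 0 :=
  (h.realizes_zero A 0).of_iso
    { hom := biprod.fst
      inv := biprod.inl
      hom_inv_id := by ext; simp }
    (by simp) ((isZero_zero C).eq_of_tgt _ _)

open ZeroObject in
theorem realizes_id_right (h : 𝓔.IsExtriangulated) (Z : C) :
    𝓔.Realizes (0 : 0 ⟶ Z) (𝟙 Z) 0 :=
  (h.realizes_zero 0 Z).of_iso
    { hom := biprod.snd
      inv := biprod.inr
      hom_inv_id := by ext; simp }
    ((isZero_zero C).eq_of_src _ _) (by simp)

section Exactness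

variable {A B Z : C} {x : A ⟶ B} {y : B ⟶ Z} {δ : 𝓔.Ext Z A}

theorem comp_eq_zero (h : 𝓔.IsExtriangulated) (hδ : 𝓔.Realizes x y δ) : x ≫ y = 0 := by
  obtain ⟨c, hc, -⟩ := h.et3 (h.realizes_id_left A) hδ (𝟙 A) x (by simp)
  simpa using hc.symm

theorem push_left_eq_zero (h : 𝓔.IsExtriangulated) (hδ : 𝓔.Realizes x y δ) :
    𝓔.push x δ = 0 := by
  obtain ⟨c, -, hc⟩ := h.et3 hδ (h.realizes_id_left B) x (𝟙 B) rfl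
  simpa [IsExtHom] using hc

theorem pull_right_eq_zero (h : 𝓔.IsExtriangulated) (hδ : 𝓔.Realizes x y δ) :
    𝓔.pull y δ = 0 := by
  obtain ⟨a, -, ha⟩ := h.et3_op (h.realizes_id_right B) hδ (𝟙 B) y (by simp)
  simpa [IsExtHom] using ha.symm

theorem exists_lift_of_pull (h : 𝓔.IsExtriangulated) (hδ : 𝓔.Realizes x y δ) {T : C} (t : T ⟶ Z)
    (ht : 𝓔.pull t δ = 0) : ∃ b : T ⟶ B, b ≫ y = t := by
  obtain ⟨b, -, hb⟩ := h.realization (h.realizes_id_right T) hδ 0 t (by simp [IsExtHom, ht])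
  exact ⟨b, by simpa using hb.symm⟩

theorem exists_desc_of_push (h : 𝓔.IsExtriangulated) (hδ : 𝓔.Realizes x y δ) {T : C} (t : A ⟶ T)
    (ht : 𝓔.push t δ = 0) : ∃ b : B ⟶ T, x ≫ b = t := by
  obtain ⟨b, hb, -⟩ := h.realization hδ (h.realizes_id_left T) t 0 (by simp [IsExtHom, ht])
  exact ⟨b, by simpa using hb⟩

theorem exists_lift_of_comp (h : 𝓔.IsExtriangulated) (hδ : 𝓔.Realizes x y δ) {T : C} (t : T ⟶ B)
    (ht : t ≫ y = 0) : ∃ a : T ⟶ A, a ≫ x = t := by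
  obtain ⟨a, ha, -⟩ := h.et3_op (h.realizes_id_left T) hδ t 0 (by simp [ht])
  exact ⟨a, by simpa using ha.symm⟩

theorem exists_desc_of_comp (h : 𝓔.IsExtriangulated) (hδ : 𝓔.Realizes x y δ) {T : C} (t : B ⟶ T)
    (ht : x ≫ t = 0) : ∃ c : Z ⟶ T, y ≫ c = t := by
  obtain ⟨c, hc, -⟩ := h.et3 hδ (h.realizes_id_right T) 0 t (by simp [ht])
  exact ⟨c, by simpa using hc⟩

end Exactness

/-- If `x` is an inflation, then so is `(x, f)` for every morphism `f` with the same source. -/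
theorem exists_realizes_lift (h : 𝓔.IsExtriangulated) {A B Z T : C} {x : A ⟶ B} {y : B ⟶ Z}
    {δ : 𝓔.Ext Z A} (hδ : 𝓔.Realizes x y δ) (f : A ⟶ T) :
    ∃ (N : C) (z : B ⊞ T ⟶ N) (δ' : 𝓔.Ext N A), 𝓔.Realizes (biprod.lift x f) z δ' := by
  -- A shear automorphism of `A ⊞ T` turns `biprod.inl` into the graph of `f`. Composing the graph
  -- with the inflation `x ⊕ 𝟙` gives `(x, f)`, and (ET4) makes the composite an inflation.
  have h₁ : 𝓔.Realizes (biprod.lift (𝟙 A) f) (biprod.desc (-f) (𝟙 T)) 0 :=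
    (h.realizes_zero A T).of_iso
      { hom := biprod.desc (biprod.lift (𝟙 A) f) biprod.inr
        inv := biprod.desc (biprod.lift (𝟙 A) (-f)) biprod.inr
        hom_inv_id := by ext <;> simp [biprod.lift_eq]
        inv_hom_id := by ext <;> simp [biprod.lift_eq] }
      (by simp) (by ext <;> simp)
  obtain ⟨N, z, -, -, δ', hN, -⟩ := h.et4 h₁ (h.realizes_dirSum hδ (h.realizes_id_left T))
  refine ⟨N, z, δ', ?_⟩
  have e : biprod.lift (𝟙 A) f ≫ biprod.map x (𝟙 T) = biprod.lift x f := by ext <;> simp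
  rwa [e] at hN

/-- If `y` is a deflation, then so is `(y, f)` for every morphism `f` with the same target. -/
theorem exists_realizes_desc (h : 𝓔.IsExtriangulated) {A B Z T : C} {x : A ⟶ B} {y : B ⟶ Z}
    {δ : 𝓔.Ext Z A} (hδ : 𝓔.Realizes x y δ) (f : T ⟶ Z) :
    ∃ (N : C) (z : N ⟶ T ⊞ B) (δ' : 𝓔.Ext Z N), 𝓔.Realizes z (biprod.desc f y) δ' := by
  have h₁ : 𝓔.Realizes (biprod.lift (𝟙 T) (-f)) (biprod.desc f (𝟙 Z)) 0 :=
    (h.realizes_zero T Z).of_iso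
      { hom := biprod.desc (biprod.lift (𝟙 T) (-f)) biprod.inr
        inv := biprod.desc (biprod.lift (𝟙 T) f) biprod.inr
        hom_inv_id := by ext <;> simp [biprod.lift_eq]
        inv_hom_id := by ext <;> simp [biprod.lift_eq] }
      (by simp) (by ext <;> simp)
  obtain ⟨N, z, -, -, δ', hN, -⟩ := h.et4_op (h.realizes_dirSum (h.realizes_id_right T) hδ) h₁
  refine ⟨N, z, δ', ?_⟩
  have e : biprod.map (𝟙 T) y ≫ biprod.desc f (𝟙 Z) = biprod.desc f y := by ext <;> simp
  rwa [e] at hN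

/-- The homotopy pullback `M` of two deflations `y₁`, `y₂` with the same target: `M ⟶ B₂` is a weak
cokernel of `A₁ ⟶ M`, and every morphism to `B₁` compatible with one to `B₂` lifts to `M`. -/
theorem exists_pullback (h : 𝓔.IsExtriangulated) {A₁ B₁ A₂ B₂ Z : C}
    {x₁ : A₁ ⟶ B₁} {y₁ : B₁ ⟶ Z} {δ₁ : 𝓔.Ext Z A₁} {x₂ : A₂ ⟶ B₂} {y₂ : B₂ ⟶ Z} {δ₂ : 𝓔.Ext Z A₂}
    (h₁ : 𝓔.Realizes x₁ y₁ δ₁) (h₂ : 𝓔.Realizes x₂ y₂ δ₂) :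
    ∃ (M : C) (m : A₁ ⟶ M) (e₁ : M ⟶ B₁) (e₂ : M ⟶ B₂), m ≫ e₁ = x₁ ∧
      (∀ {T : C} (g : M ⟶ T), m ≫ g = 0 → ∃ c, e₂ ≫ c = g) ∧
      ∀ {T : C} (t : T ⟶ B₁) (s : T ⟶ B₂), t ≫ y₁ = s ≫ y₂ → ∃ r, r ≫ e₁ = t := by
  -- One extension of `Z` by `A₁ ⊞ A₂` with components `δ₁`, `δ₂`. By (ET4), dividing its middle
  -- term `M` by `A₂` leaves a realization of `δ₁`, hence `B₁`; dividing by `A₁` leaves `B₂`.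
  obtain ⟨M, g, g', hg⟩ := 𝓔.exists_realizes
    (𝓔.push (biprod.inl : A₁ ⟶ A₁ ⊞ A₂) δ₁ + 𝓔.push biprod.inr δ₂)
  have split : 𝓔.Realizes (biprod.inr : A₂ ⟶ A₁ ⊞ A₂) (biprod.fst : A₁ ⊞ A₂ ⟶ A₁) 0 :=
    (h.realizes_zero A₂ A₁).of_iso (biprod.braiding _ _) (by ext <;> simp) (by simp)
  obtain ⟨N₁, p₁, d₁, q₁, η₁, hM₁, hd₁, -, hN₁, -, hη₁⟩ := h.et4 split hg
  obtain ⟨N₂, p₂, d₂, q₂, η₂, hM₂, hd₂, -, hN₂, -, -⟩ := h.et4 (h.realizes_zero A₁ A₂) hg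
  rw [push_add_right, push_push, push_push, biprod.inl_fst, biprod.inr_fst, push_id,
    h.push_zero_left, add_zero] at hN₁
  rw [push_add_right, push_push, push_push, biprod.inl_snd, biprod.inr_snd, push_id,
    h.push_zero_left, zero_add] at hN₂
  obtain ⟨i₁, hi₁, hi₁'⟩ := hN₁.exists_iso h₁
  obtain ⟨i₂, hi₂, hi₂'⟩ := hN₂.exists_iso h₂
  -- The extension of `A₂ ⟶ M ⟶ N₁` is the pullback of `δ₂`, so the obstruction to lifting `t` is
  -- the pullback of `δ₂` along `t ≫ y₁ = s ≫ y₂`, which vanishes because `y₂` already annihilates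
  -- `δ₂`.
  have k₁ : η₁ = 𝓔.pull q₁ δ₂ := by
    have := congrArg (𝓔.push biprod.snd) hη₁
    simpa [push_push, push_pull, push_add_right, h.push_zero_left] using this
  refine ⟨M, biprod.inl ≫ g, p₁ ≫ i₁.hom, p₂ ≫ i₂.hom, ?_, fun {T} t ht => ?_,
    fun {T} t s hts => ?_⟩
  · rw [Category.assoc, ← reassoc_of% hd₁, hi₁, biprod.inl_fst_assoc]
  · obtain ⟨c, hc⟩ := h.exists_desc_of_comp hM₂ t ht
    exact ⟨i₂.inv ≫ c, by simpa using hc⟩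
  · obtain ⟨r, hr⟩ := h.exists_lift_of_pull hM₁ (t ≫ i₁.inv) (by
      rw [k₁, pull_pull, Category.assoc, ← hi₁', i₁.inv_hom_id_assoc, hts, ← pull_pull,
        h.pull_right_eq_zero h₂, pull_zero_right])
    exact ⟨r, by rw [reassoc_of% hr]; simp⟩

/-- The homotopy pushout `M` of two inflations `x₁`, `x₂` with the same source: `B₂ ⟶ M` is a weak
kernel of `M ⟶ Z₁`, and every morphism from `B₁` compatible with one from `B₂` extends to `M`. -/
theorem exists_pushout (h : 𝓔.IsExtriangulated) {A B₁ Z₁ B₂ Z₂ : C}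
    {x₁ : A ⟶ B₁} {y₁ : B₁ ⟶ Z₁} {δ₁ : 𝓔.Ext Z₁ A} {x₂ : A ⟶ B₂} {y₂ : B₂ ⟶ Z₂} {δ₂ : 𝓔.Ext Z₂ A}
    (h₁ : 𝓔.Realizes x₁ y₁ δ₁) (h₂ : 𝓔.Realizes x₂ y₂ δ₂) :
    ∃ (M : C) (m : M ⟶ Z₁) (e₁ : B₁ ⟶ M) (e₂ : B₂ ⟶ M), e₁ ≫ m = y₁ ∧
      (∀ {T : C} (g : T ⟶ M), g ≫ m = 0 → ∃ c, c ≫ e₂ = g) ∧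
      ∀ {T : C} (t : B₁ ⟶ T) (s : B₂ ⟶ T), x₁ ≫ t = x₂ ≫ s → ∃ r, e₁ ≫ r = t := by
  -- Dually, an extension of `Z₁ ⊞ Z₂` by `A`; restricting it to `Z₁` or `Z₂` recovers `B₁` or `B₂`.
  obtain ⟨M, g', g, hg⟩ := 𝓔.exists_realizes
    (𝓔.pull (biprod.fst : Z₁ ⊞ Z₂ ⟶ Z₁) δ₁ + 𝓔.pull biprod.snd δ₂)
  have split : 𝓔.Realizes (biprod.inr : Z₂ ⟶ Z₁ ⊞ Z₂) (biprod.fst : Z₁ ⊞ Z₂ ⟶ Z₁) 0 :=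
    (h.realizes_zero Z₂ Z₁).of_iso (biprod.braiding _ _) (by ext <;> simp) (by simp)
  obtain ⟨N₁, p₁, d₁, q₁, η₁, hM₁, hd₁, -, hN₁, -, hη₁⟩ := h.et4_op hg (h.realizes_zero Z₁ Z₂)
  obtain ⟨N₂, p₂, d₂, q₂, η₂, hM₂, hd₂, -, hN₂, -, -⟩ := h.et4_op hg split
  rw [pull_add_right, pull_pull, pull_pull, biprod.inl_fst, biprod.inl_snd, pull_id,
    h.pull_zero_left, add_zero] at hN₁
  rw [pull_add_right, pull_pull, pull_pull, biprod.inr_fst, biprod.inr_snd, pull_id,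
    h.pull_zero_left, zero_add] at hN₂
  obtain ⟨i₁, hi₁, hi₁'⟩ := hN₁.exists_iso h₁
  obtain ⟨i₂, hi₂, hi₂'⟩ := hN₂.exists_iso h₂
  have k₁ : η₁ = 𝓔.push d₁ δ₂ := by
    have := congrArg (𝓔.pull biprod.inr) hη₁
    simpa [pull_pull, ← push_pull, pull_add_right, h.pull_zero_left] using this
  refine ⟨M, g ≫ biprod.fst, i₁.inv ≫ p₁, i₂.inv ≫ p₂, ?_, fun {T} t ht => ?_,
    fun {T} t s hts => ?_⟩
  · rw [Category.assoc, reassoc_of% hd₁, biprod.inl_fst, Category.comp_id, ← hi₁',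
      i₁.inv_hom_id_assoc]
  · obtain ⟨c, hc⟩ := h.exists_lift_of_comp hM₂ t ht
    exact ⟨c ≫ i₂.hom, by simpa using hc⟩
  · obtain ⟨r, hr⟩ := h.exists_desc_of_push hM₁ (i₁.hom ≫ t) (by
      rw [k₁, push_push, reassoc_of% hi₁, hts, ← push_push,
        h.push_left_eq_zero h₂, push_zero_right])
    exact ⟨r, by rw [Category.assoc, hr]; simp⟩

end IsExtriangulated

end ExtensionData

/-! ### Kernels, cokernels and factorisations modulo `𝒳`, constructed in `C`. -/

theorem IsRightApprox.exists_lift {C : Type u} [Category.{v} C] {𝒳 : ObjectProperty C}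
    {A B : C} {d : A ⟶ B} (hd : IsRightApprox 𝒳 d) {X : C} (hX : 𝒳 X)
    (f : X ⟶ B) : ∃ g, g ≫ d = f :=
  hd.2 X hX f

theorem IsLeftApprox.exists_desc {C : Type u} [Category.{v} C] {𝒳 : ObjectProperty C}
    {A B : C} {a : A ⟶ B} (ha : IsLeftApprox 𝒳 a) {X : C} (hX : 𝒳 X)
    (f : A ⟶ X) : ∃ g, a ≫ g = f :=
  ha.2 X hX f

theorem mem_factorSubgroup_of_comp {C : Type u} [Category.{v} C] [Preadditive C]
    {𝒳 : ObjectProperty C} {A X B : C} (hX : 𝒳 X) (i : A ⟶ X) (p : X ⟶ B) :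
    i ≫ p ∈ factorSubgroup 𝒳 A B :=
  AddSubgroup.subset_closure ⟨X, hX, i, p, rfl⟩

section

variable {C : Type u} [Category.{v} C] [Preadditive C] [HasZeroObject C] [HasBinaryBiproducts C]
  {𝓔 : ExtensionData.{w} C} {𝒳 : ObjectProperty C}

namespace IsPseudoClusterTilting

/-- The triangle is `X₃ ⟶ K ⟶ A` with extension `f^* η`. Lifts along `k` are obstructed by pullbacks
of `η`, which die on anything factoring through `d`; `k` is monic modulo `𝒳` because what it
annihilates factors through `X₃`. The lifts are strict in `C`, not only modulo `𝒳`. -/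
theorem exists_kernel (h : IsPseudoClusterTilting 𝓔 𝒳) (h𝓔 : 𝓔.IsExtriangulated) {A B : C}
    (f : A ⟶ B) :
    ∃ (K : C) (k : K ⟶ A), k ≫ f ∈ factorSubgroup 𝒳 K B ∧
      (∀ {W : C} (g : W ⟶ A), g ≫ f ∈ factorSubgroup 𝒳 W B → ∃ l, l ≫ k = g) ∧
      ∀ {W : C} (g : W ⟶ K), g ≫ k ∈ factorSubgroup 𝒳 W A → g ∈ factorSubgroup 𝒳 W K := by
  obtain ⟨X₃, X₄, c, d, η, hη, hX₃, hX₄, hd⟩ := h.exists_right B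
  obtain ⟨K, i, k, hK⟩ := 𝓔.exists_realizes (𝓔.pull f η)
  have lift {W : C} (g : W ⟶ A) (hg : g ≫ f ∈ factorSubgroup 𝒳 W B) : ∃ l, l ≫ k = g := by
    obtain ⟨X, hX, u, v, huv⟩ := (h.mem_factorSubgroup_iff _).1 hg
    obtain ⟨v', rfl⟩ := hd.exists_lift hX v
    refine h𝓔.exists_lift_of_pull hK g ?_
    rw [ExtensionData.pull_pull, ← huv, ← ExtensionData.pull_pull, ← ExtensionData.pull_pull,
      h𝓔.pull_right_eq_zero hη, ExtensionData.pull_zero_right, ExtensionData.pull_zero_right]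
  refine ⟨K, k, ?_, lift, fun {W} g hg => ?_⟩
  · obtain ⟨q, hq⟩ := h𝓔.exists_lift_of_pull hη (k ≫ f) (by
      rw [← ExtensionData.pull_pull, h𝓔.pull_right_eq_zero hK])
    exact hq ▸ mem_factorSubgroup_of_comp hX₄ q d
  · obtain ⟨X, hX, u, v, huv⟩ := (h.mem_factorSubgroup_iff _).1 hg
    -- The source of `v` lies in `𝒳`, so `v ≫ f` is zero modulo `𝒳` and `v` lifts to `K`;
    -- subtracting `u ≫ v'` reduces to `g ≫ k = 0`.
    obtain ⟨v', rfl⟩ := lift v (by simpa using mem_factorSubgroup_of_comp hX (𝟙 X) (v ≫ f))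
    obtain ⟨r, hr⟩ := h𝓔.exists_lift_of_comp hK (g - u ≫ v') (by simp [huv])
    rw [← sub_add_cancel g (u ≫ v'), ← hr]
    exact add_mem (mem_factorSubgroup_of_comp hX₃ _ _) (mem_factorSubgroup_of_comp hX _ _)

theorem exists_cokernel (h : IsPseudoClusterTilting 𝓔 𝒳) (h𝓔 : 𝓔.IsExtriangulated) {A B : C}
    (f : A ⟶ B) :
    ∃ (L : C) (l : B ⟶ L), f ≫ l ∈ factorSubgroup 𝒳 A L ∧
      (∀ {W : C} (g : B ⟶ W), f ≫ g ∈ factorSubgroup 𝒳 A W → ∃ k, l ≫ k = g) ∧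
      ∀ {W : C} (g : L ⟶ W), l ≫ g ∈ factorSubgroup 𝒳 B W → g ∈ factorSubgroup 𝒳 L W := by
  obtain ⟨X₁, X₂, a, b, δ, hδ, hX₁, hX₂, ha⟩ := h.exists_left A
  obtain ⟨L, l, j, hL⟩ := 𝓔.exists_realizes (𝓔.push f δ)
  have desc {W : C} (g : B ⟶ W) (hg : f ≫ g ∈ factorSubgroup 𝒳 A W) : ∃ k, l ≫ k = g := by
    obtain ⟨X, hX, u, v, huv⟩ := (h.mem_factorSubgroup_iff _).1 hg
    obtain ⟨u', rfl⟩ := ha.exists_desc hX u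
    refine h𝓔.exists_desc_of_push hL g ?_
    rw [ExtensionData.push_push, ← huv, Category.assoc, ← ExtensionData.push_push,
      h𝓔.push_left_eq_zero hδ, ExtensionData.push_zero_right]
  refine ⟨L, l, ?_, desc, fun {W} g hg => ?_⟩
  · obtain ⟨q, hq⟩ := h𝓔.exists_desc_of_push hδ (f ≫ l) (by
      rw [← ExtensionData.push_push, h𝓔.push_left_eq_zero hL])
    exact hq ▸ mem_factorSubgroup_of_comp hX₁ a q
  · obtain ⟨X, hX, u, v, huv⟩ := (h.mem_factorSubgroup_iff _).1 hg
    obtain ⟨u', rfl⟩ := desc u (by simpa using mem_factorSubgroup_of_comp hX (f ≫ u) (𝟙 X))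
    obtain ⟨r, hr⟩ := h𝓔.exists_desc_of_comp hL (g - u' ≫ v) (by simp [← huv])
    rw [← sub_add_cancel g (u' ≫ v), ← hr]
    exact add_mem (mem_factorSubgroup_of_comp hX₂ _ _) (mem_factorSubgroup_of_comp hX _ _)

/-- Modulo `𝒳`, every morphism is an epimorphism followed by a weak kernel. -/
theorem exists_epi_weakKernel (h : IsPseudoClusterTilting 𝓔 𝒳) (h𝓔 : 𝓔.IsExtriangulated) {A B : C}
    (f : A ⟶ B) :
    ∃ (K L : C) (e : A ⟶ K) (n : K ⟶ B) (c : B ⟶ L), e ≫ n = f ∧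
      f ≫ c ∈ factorSubgroup 𝒳 A L ∧
      (∀ {W : C} (g : K ⟶ W), e ≫ g ∈ factorSubgroup 𝒳 A W → g ∈ factorSubgroup 𝒳 K W) ∧
      ∀ {W : C} (g : W ⟶ B), g ≫ c ∈ factorSubgroup 𝒳 W L → ∃ l, l ≫ n = g := by
  obtain ⟨X₁, X₂, a, b, δ, hδ, hX₁, hX₂, ha⟩ := h.exists_left A
  obtain ⟨L, z, δ', hL⟩ := h𝓔.exists_realizes_lift hδ f
  obtain ⟨X₃, X₄, c, d, η, hη, hX₃, hX₄, hd⟩ := h.exists_right L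
  obtain ⟨K, e, n, q, hen, hcok, hlift⟩ := h𝓔.exists_pullback hL hη
  have hea : e ≫ n ≫ biprod.fst = a := by rw [reassoc_of% hen, biprod.lift_fst]
  refine ⟨K, L, e, n ≫ biprod.snd, biprod.inr ≫ z, ?_, ?_, fun {W} g hg => ?_,
    fun {W} g hg => ?_⟩
  · rw [reassoc_of% hen, biprod.lift_snd]
  -- The two components of `(a, f) ≫ z = 0` cancel.
  · have : f ≫ biprod.inr ≫ z = a ≫ (-(biprod.inl ≫ z)) := by
      rw [Preadditive.comp_neg, eq_neg_iff_add_eq_zero, add_comm, ← h𝓔.comp_eq_zero hL,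
        biprod.lift_eq]
      simp
    exact this ▸ mem_factorSubgroup_of_comp hX₁ _ _
  · obtain ⟨X, hX, u, v, huv⟩ := (h.mem_factorSubgroup_iff _).1 hg
    obtain ⟨u', rfl⟩ := ha.exists_desc hX u
    -- The approximation `a` factors through `e`, so a morphism `e ≫ g` that factors through `𝒳` can
    -- be corrected to zero; the corrected `g` then factors through `X₄`, the weak cokernel of `e`.
    obtain ⟨r, hr⟩ := hcok (g - (n ≫ biprod.fst) ≫ u' ≫ v) (by
      rw [Preadditive.comp_sub, ← huv, ← Category.assoc e, hea, Category.assoc, sub_self])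
    rw [← sub_add_cancel g ((n ≫ biprod.fst) ≫ u' ≫ v), ← hr, ← Category.assoc _ u' v]
    exact add_mem (mem_factorSubgroup_of_comp hX₄ _ _) (mem_factorSubgroup_of_comp hX _ _)
  · obtain ⟨X, hX, u, v, huv⟩ := (h.mem_factorSubgroup_iff _).1 hg
    obtain ⟨v', rfl⟩ := hd.exists_lift hX v
    obtain ⟨r, hr⟩ := hlift (g ≫ biprod.inr) (u ≫ v') (by simp [huv])
    exact ⟨r, by rw [reassoc_of% hr]; simp⟩

/-- Modulo `𝒳`, every morphism is a weak cokernel followed by a monomorphism. -/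
theorem exists_weakCokernel_mono (h : IsPseudoClusterTilting 𝓔 𝒳) (h𝓔 : 𝓔.IsExtriangulated)
    {A B : C} (f : A ⟶ B) :
    ∃ (K L : C) (e : A ⟶ K) (n : K ⟶ B) (c : L ⟶ A), e ≫ n = f ∧
      c ≫ f ∈ factorSubgroup 𝒳 L B ∧
      (∀ {W : C} (g : W ⟶ K), g ≫ n ∈ factorSubgroup 𝒳 W B → g ∈ factorSubgroup 𝒳 W K) ∧
      ∀ {W : C} (g : A ⟶ W), c ≫ g ∈ factorSubgroup 𝒳 L W → ∃ l, e ≫ l = g := by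
  obtain ⟨X₃, X₄, c, d, η, hη, hX₃, hX₄, hd⟩ := h.exists_right B
  obtain ⟨L, z, δ', hL⟩ := h𝓔.exists_realizes_desc hη f
  obtain ⟨X₁, X₂, a, b, δ, hδ, hX₁, hX₂, ha⟩ := h.exists_left L
  obtain ⟨K, n, e, q, hen, hker, hdesc⟩ := h𝓔.exists_pushout hL hδ
  have hnd : (biprod.inr ≫ e) ≫ n = d := by rw [Category.assoc, hen, biprod.inr_desc]
  refine ⟨K, L, biprod.inl ≫ e, n, z ≫ biprod.fst, ?_, ?_, fun {W} g hg => ?_,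
    fun {W} g hg => ?_⟩
  · rw [Category.assoc, hen, biprod.inl_desc]
  · have : (z ≫ biprod.fst) ≫ f = (-(z ≫ biprod.snd)) ≫ d := by
      rw [Preadditive.neg_comp, eq_neg_iff_add_eq_zero, ← h𝓔.comp_eq_zero hL,
        biprod.desc_eq]
      simp
    exact this ▸ mem_factorSubgroup_of_comp hX₄ _ _
  · obtain ⟨X, hX, u, v, huv⟩ := (h.mem_factorSubgroup_iff _).1 hg
    obtain ⟨v', rfl⟩ := hd.exists_lift hX v
    obtain ⟨r, hr⟩ := hker (g - u ≫ v' ≫ biprod.inr ≫ e) (by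
      rw [Preadditive.sub_comp, ← huv, Category.assoc, Category.assoc, hnd, sub_self])
    rw [← sub_add_cancel g (u ≫ v' ≫ biprod.inr ≫ e), ← hr]
    exact add_mem (mem_factorSubgroup_of_comp hX₁ _ _) (mem_factorSubgroup_of_comp hX _ _)
  · obtain ⟨X, hX, u, v, huv⟩ := (h.mem_factorSubgroup_iff _).1 hg
    obtain ⟨u', rfl⟩ := ha.exists_desc hX u
    obtain ⟨r, hr⟩ := hdesc (biprod.fst ≫ g) (u' ≫ v) (by simpa using huv.symm)
    exact ⟨r, by rw [Category.assoc, hr]; simp⟩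

end IsPseudoClusterTilting

end

/-! ### A criterion for the coimage-image comparison to be epi or mono. -/

namespace CategoryTheory.Abelian

variable {D : Type u} [Category.{v} D] [Preadditive D] [HasKernels D] [HasCokernels D]

/-- Since `c` factors through the cokernel of `f`, the image inclusion lifts along `n`; since `e` is
epi, `n` itself lands in the image. Thus Im `f` is a retract of `K`, and `A ⟶` Im `f` is `e`
followed by a split epimorphism. Uniqueness of lifts along `n` is not needed. -/
theorem epi_coimageImageComparison_of_factorisation {A B K L : D} {f : A ⟶ B} (e : A ⟶ K)
    (n : K ⟶ B) (c : B ⟶ L) (hen : e ≫ n = f) (hc : f ≫ c = 0) [Epi e]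
    (hn : ∀ {W : D} (g : W ⟶ B), g ≫ c = 0 → ∃ l, l ≫ n = g) :
    Epi (coimageImageComparison f) := by
  have hι : Abelian.image.ι f ≫ c = 0 := by
    rw [← cokernel.π_desc f c hc, kernel.condition_assoc, zero_comp]
  obtain ⟨j, hj⟩ := hn _ hι
  have hnc : n ≫ cokernel.π f = 0 := by
    rw [← cancel_epi e, reassoc_of% hen, cokernel.condition, comp_zero]
  let j' : K ⟶ Abelian.image f := kernel.lift _ n hnc
  have hj' : j' ≫ Abelian.image.ι f = n := kernel.lift_ι _ _ _
  have hjj' : j ≫ j' = 𝟙 _ := by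
    rw [← cancel_mono (Abelian.image.ι f), Category.assoc, hj', hj, Category.id_comp]
  have : IsSplitEpi j' := ⟨⟨⟨j, hjj'⟩⟩⟩
  have hf : Abelian.coimage.π f ≫ coimageImageComparison f = e ≫ j' := by
    rw [← cancel_mono (Abelian.image.ι f), Category.assoc, Category.assoc, hj', hen,
      coimage_image_factorisation]
  have : Epi (Abelian.coimage.π f ≫ coimageImageComparison f) := hf ▸ epi_comp e j'
  exact epi_of_epi (Abelian.coimage.π f) _

theorem mono_coimageImageComparison_of_factorisation {A B K L : D} {f : A ⟶ B} (e : A ⟶ K)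
    (n : K ⟶ B) (c : L ⟶ A) (hen : e ≫ n = f) (hc : c ≫ f = 0) [Mono n]
    (he : ∀ {W : D} (g : A ⟶ W), c ≫ g = 0 → ∃ l, e ≫ l = g) :
    Mono (coimageImageComparison f) := by
  have hπ : c ≫ Abelian.coimage.π f = 0 := by
    rw [← kernel.lift_ι f c hc, Category.assoc, cokernel.condition, comp_zero]
  obtain ⟨j, hj⟩ := he _ hπ
  have hke : kernel.ι f ≫ e = 0 := by
    rw [← cancel_mono n, Category.assoc, hen, kernel.condition, zero_comp]
  let j' : Abelian.coimage f ⟶ K := cokernel.desc _ e hke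
  have hj' : Abelian.coimage.π f ≫ j' = e := cokernel.π_desc _ _ _
  have hjj' : j' ≫ j = 𝟙 _ := by
    rw [← cancel_epi (Abelian.coimage.π f), reassoc_of% hj', hj, Category.comp_id]
  have : IsSplitMono j' := ⟨⟨⟨j, hjj'⟩⟩⟩
  have hf : coimageImageComparison f ≫ Abelian.image.ι f = j' ≫ n := by
    rw [← cancel_epi (Abelian.coimage.π f), reassoc_of% hj', hen,
      coimage_image_factorisation]
  have : Mono (coimageImageComparison f ≫ Abelian.image.ι f) := hf ▸ mono_comp j' n
  exact mono_of_mono _ (Abelian.image.ι f)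

end CategoryTheory.Abelian

/-! ### Transfer to `C/𝒳` along the full projection functor. -/

namespace AdditiveQuotient

variable {C : Type u} [Category.{v} C] [Preadditive C] (𝒳 : ObjectProperty C)

/-- The projection `C ⥤ C/𝒳`. -/
abbrev proj : C ⥤ AdditiveQuotient 𝒳 := CategoryTheory.Quotient.functor (factorRel 𝒳)

instance : (proj 𝒳).Additive where
  map_add := rfl

variable {𝒳}

theorem proj_map_eq_zero_iff {A B : C} (f : A ⟶ B) :
    (proj 𝒳).map f = 0 ↔ f ∈ factorSubgroup 𝒳 A B := by
  rw [← (proj 𝒳).map_zero, CategoryTheory.Quotient.functor_map_eq_iff, factorRel, sub_zero]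

theorem proj_map_comp_eq_zero_iff {A B Z : C} (f : A ⟶ B) (g : B ⟶ Z) :
    (proj 𝒳).map f ≫ (proj 𝒳).map g = 0 ↔ f ≫ g ∈ factorSubgroup 𝒳 A Z := by
  rw [← (proj 𝒳).map_comp, proj_map_eq_zero_iff]

theorem mono_proj_map {K A : C} (k : K ⟶ A)
    (hk : ∀ {W : C} (g : W ⟶ K), g ≫ k ∈ factorSubgroup 𝒳 W A → g ∈ factorSubgroup 𝒳 W K) :
    Mono ((proj 𝒳).map k) := by
  refine Preadditive.mono_of_cancel_zero _ fun {G} g hg => ?_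
  obtain ⟨g, rfl⟩ := (proj 𝒳).map_surjective (X := G.as) g
  exact (proj_map_eq_zero_iff g).2 (hk g ((proj_map_comp_eq_zero_iff g k).1 hg))

theorem epi_proj_map {A K : C} (e : A ⟶ K)
    (he : ∀ {W : C} (g : K ⟶ W), e ≫ g ∈ factorSubgroup 𝒳 A W → g ∈ factorSubgroup 𝒳 K W) :
    Epi ((proj 𝒳).map e) := by
  refine Preadditive.epi_of_cancel_zero _ fun {G} g hg => ?_
  obtain ⟨g, rfl⟩ := (proj 𝒳).map_surjective (Y := G.as) g
  exact (proj_map_eq_zero_iff g).2 (he g ((proj_map_comp_eq_zero_iff e g).1 hg))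

theorem exists_lift_proj_map {K A L : C} {k : K ⟶ A} {c : A ⟶ L}
    (hk : ∀ {W : C} (g : W ⟶ A), g ≫ c ∈ factorSubgroup 𝒳 W L → ∃ l, l ≫ k = g)
    {W : AdditiveQuotient 𝒳} (g : W ⟶ (proj 𝒳).obj A) (hg : g ≫ (proj 𝒳).map c = 0) :
    ∃ l, l ≫ (proj 𝒳).map k = g := by
  obtain ⟨g, rfl⟩ := (proj 𝒳).map_surjective (X := W.as) g
  obtain ⟨l, rfl⟩ := hk g ((proj_map_comp_eq_zero_iff g c).1 hg)
  exact ⟨(proj 𝒳).map l, ((proj 𝒳).map_comp l k).symm⟩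

theorem exists_desc_proj_map {A K L : C} {e : A ⟶ K} {c : L ⟶ A}
    (he : ∀ {W : C} (g : A ⟶ W), c ≫ g ∈ factorSubgroup 𝒳 L W → ∃ l, e ≫ l = g)
    {W : AdditiveQuotient 𝒳} (g : (proj 𝒳).obj A ⟶ W) (hg : (proj 𝒳).map c ≫ g = 0) :
    ∃ l, (proj 𝒳).map e ≫ l = g := by
  obtain ⟨g, rfl⟩ := (proj 𝒳).map_surjective (Y := W.as) g
  obtain ⟨l, rfl⟩ := he g ((proj_map_comp_eq_zero_iff c g).1 hg)
  exact ⟨(proj 𝒳).map l, ((proj 𝒳).map_comp e l).symm⟩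

variable (𝒳) in
theorem hasZeroObject [HasZeroObject C] : HasZeroObject (AdditiveQuotient 𝒳) :=
  ⟨_, (proj 𝒳).map_isZero (isZero_zero C)⟩

variable (𝒳) in
theorem hasBinaryBiproducts [HasBinaryBiproducts C] :
    HasBinaryBiproducts (AdditiveQuotient 𝒳) where
  has_binary_biproduct P Q :=
    hasBinaryBiproduct_of_total ((proj 𝒳).mapBinaryBicone (BinaryBiproduct.bicone P.as Q.as))
      (congrArg (proj 𝒳).map (biprod.total (X := P.as) (Y := Q.as)))

variable [HasZeroObject C] [HasBinaryBiproducts C] {𝓔 : ExtensionData.{w} C}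

theorem hasKernels (h : IsPseudoClusterTilting 𝓔 𝒳) (h𝓔 : 𝓔.IsExtriangulated) :
    HasKernels (AdditiveQuotient 𝒳) where
  has_limit {P Q} f := by
    obtain ⟨f, rfl⟩ := (proj 𝒳).map_surjective (X := P.as) (Y := Q.as) f
    obtain ⟨K, k, hkf, hlift, hmono⟩ := h.exists_kernel h𝓔 f
    have := mono_proj_map k hmono
    -- As `k` is mono in the quotient, any chosen lift is the unique one.
    exact ⟨⟨_, KernelFork.IsLimit.ofι' ((proj 𝒳).map k) ((proj_map_comp_eq_zero_iff k f).2 hkf)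
      fun g hg => ⟨_, (exists_lift_proj_map hlift g hg).choose_spec⟩⟩⟩

theorem hasCokernels (h : IsPseudoClusterTilting 𝓔 𝒳) (h𝓔 : 𝓔.IsExtriangulated) :
    HasCokernels (AdditiveQuotient 𝒳) where
  has_colimit {P Q} f := by
    obtain ⟨f, rfl⟩ := (proj 𝒳).map_surjective (X := P.as) (Y := Q.as) f
    obtain ⟨L, l, hfl, hdesc, hepi⟩ := h.exists_cokernel h𝓔 f
    have := epi_proj_map l hepi
    exact ⟨⟨_, CokernelCofork.IsColimit.ofπ' ((proj 𝒳).map l)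
      ((proj_map_comp_eq_zero_iff f l).2 hfl)
      fun g hg => ⟨_, (exists_desc_proj_map hdesc g hg).choose_spec⟩⟩⟩

end AdditiveQuotient

/-- The quotient of an extriangulated category by a pseudo cluster tilting subcategory is
semi-abelian. -/
theorem theorem3p9 {C : Type u} [Category.{v} C] [Preadditive C] [HasZeroObject C]
    [HasBinaryBiproducts C] (𝓔 : ExtensionData.{w} C) (h𝓔 : 𝓔.IsExtriangulated)
    (𝒳 : ObjectProperty C) (h𝒳 : IsPseudoClusterTilting 𝓔 𝒳) :
    IsSemiAbelian (AdditiveQuotient 𝒳) := by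
  have hk := AdditiveQuotient.hasKernels h𝒳 h𝓔
  have hc := AdditiveQuotient.hasCokernels h𝒳 h𝓔
  refine ⟨AdditiveQuotient.hasZeroObject 𝒳, AdditiveQuotient.hasBinaryBiproducts 𝒳, hk, hc,
    fun {P Q} f => ?_, fun {P Q} f => ?_⟩
  · obtain ⟨f, rfl⟩ := (AdditiveQuotient.proj 𝒳).map_surjective (X := P.as) (Y := Q.as) f
    obtain ⟨K, L, e, n, c, rfl, hcf, hn, he⟩ := h𝒳.exists_weakCokernel_mono h𝓔 f
    have := AdditiveQuotient.mono_proj_map n hn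
    exact Abelian.mono_coimageImageComparison_of_factorisation _ _ _
      ((AdditiveQuotient.proj 𝒳).map_comp e n).symm
      ((AdditiveQuotient.proj_map_comp_eq_zero_iff c _).2 hcf)
      (AdditiveQuotient.exists_desc_proj_map he)
  · obtain ⟨f, rfl⟩ := (AdditiveQuotient.proj 𝒳).map_surjective (X := P.as) (Y := Q.as) f
    obtain ⟨K, L, e, n, c, rfl, hfc, he, hn⟩ := h𝒳.exists_epi_weakKernel h𝓔 f
    have := AdditiveQuotient.epi_proj_map e he
    exact Abelian.epi_coimageImageComparison_of_factorisation _ _ _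
      ((AdditiveQuotient.proj 𝒳).map_comp e n).symm
      ((AdditiveQuotient.proj_map_comp_eq_zero_iff _ c).2 hfc)
      (AdditiveQuotient.exists_lift_proj_map hn)
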